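/- **Theorem 2.4.** Let $\mathbb K$ be $\mathbb R$ or $\mathbb C$. Let $\mathfrak A$ be a Banach algebra over $\mathbb K$ and let $\mathfrak S$ be an abstract symmetric Segal algebra in $\mathfrak A$; that is, $\mathfrak S$ is a dense two-sided ideal of $\mathfrak A$ which is a Banach algebra under its own norm $|\cdot|$, the inclusion $\mathfrak S\to\mathfrak A$ is bounded, and there is $C>0$ with $\max\{|ba|,|ab|\}\le C|a|\,\|b\|$ for all $a\in\mathfrak S$, $b\in\mathfrak A$. Suppose that $\mathfrak A$ is amenable, i.e. for every Banach $\mathfrak A$-bimodule $Y$ every bounded derivation $\mathfrak A\to Y^*$ is inner (of the form $a\mapsto a.y-y.a$). Here a derivation from a Banach algebra $\mathfrak B$ into a Banach $\mathfrak B$-bimodule is a bounded linear map $D$ with $D(ab)=a.D(b)+D(a).b$ for all $a,b\in\mathfrak B$. 1. For every Banach $\mathfrak A$-bimodule $X$ and every derivation $D\colon\mathfrak S\to X^*$ there is a double centralizer $(S,T)$ from $\mathfrak S$ into $X^*$ with $D(a)=S(a)-T(a)$ for all $a\in\mathfrak S$. That is, $S,T\colon\mathfrak S\to X^*$ are bounded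 linear maps with $S(ab)=S(a).b$, $T(ab)=a.T(b)$ and $a.S(b)=T(a).b$ for all $a,b\in\mathfrak S$. 2. Suppose that $\mathfrak S$ has a (two-sided) approximate identity which is a bounded (two-sided) approximate identity for $\mathfrak A$. Then for every Banach $\mathfrak A$-bimodule $X$ every derivation $D\colon\mathfrak S\to X$ is approximately inner, i.e. there is a net $(x_\gamma)$ in $X$ with $D(a)=\lim_\gamma(a.x_\gamma-x_\gamma.a)$ in norm for every $a\in\mathfrak S$. In particular $\mathfrak S$ is approximately weakly amenable, i.e. every derivation $\mathfrak S\to\mathfrak S^*$ is approximately inner. -/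

import Mathlib

open Filter Topology

universe u

/-- A bimodule structure over the (not necessarily unital) Banach algebra `A` on the space `X`, with
jointly bounded left action `lact a x` (written `a.x`) and right action `ract a x` (written `x.a`).
It makes `X` a Banach `A`-bimodule when `X` is complete. -/
structure BanachBimodule (𝕜 : Type) [RCLike 𝕜]
    (A : Type u) [NonUnitalNormedRing A] [NormedSpace 𝕜 A]
    (X : Type u) [NormedAddCommGroup X] [NormedSpace 𝕜 X] where
  lact : A →L[𝕜] X →L[𝕜] X
  ract : A →L[𝕜] X →L[𝕜] X
  lact_mul : ∀ a b x, lact (a * b) x = lact a (lact b x)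
  ract_mul : ∀ a b x, ract (a * b) x = ract b (ract a x)
  lact_ract : ∀ a b x, lact a (ract b x) = ract b (lact a x)

namespace BanachBimodule

variable {𝕜 : Type} [RCLike 𝕜]
variable {A : Type u} [NonUnitalNormedRing A] [NormedSpace 𝕜 A]
variable {X : Type u} [NormedAddCommGroup X] [NormedSpace 𝕜 X]

/-- The dual bimodule `X*`: `(a.f)(x) = f(x.a)` and `(f.a)(x) = f(a.x)`. -/
noncomputable def dual (M : BanachBimodule 𝕜 A X) : BanachBimodule 𝕜 A (StrongDual 𝕜 X) where
  lact := (ContinuousLinearMap.compL 𝕜 X X 𝕜).flip ∘L M.ract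
  ract := (ContinuousLinearMap.compL 𝕜 X X 𝕜).flip ∘L M.lact
  lact_mul a b f := by ext x; simp [M.ract_mul]
  ract_mul a b f := by ext x; simp [M.lact_mul]
  lact_ract a b f := by ext x; simp [M.lact_ract]

@[simp] theorem dual_lact_apply (M : BanachBimodule 𝕜 A X) (a : A) (f : StrongDual 𝕜 X) (x : X) :
    M.dual.lact a f x = f (M.ract a x) := by simp [dual]

@[simp] theorem dual_ract_apply (M : BanachBimodule 𝕜 A X) (a : A) (f : StrongDual 𝕜 X) (x : X) :
    M.dual.ract a f x = f (M.lact a x) := by simp [dual]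

/-- `A` as a bimodule over itself, by multiplication. -/
noncomputable def self (𝕜 : Type) [RCLike 𝕜] (A : Type u) [NonUnitalNormedRing A] [NormedSpace 𝕜 A]
    [IsScalarTower 𝕜 A A] [SMulCommClass 𝕜 A A] : BanachBimodule 𝕜 A A where
  lact := ContinuousLinearMap.mul 𝕜 A
  ract := (ContinuousLinearMap.mul 𝕜 A).flip
  lact_mul a b x := by simp [mul_assoc]
  ract_mul a b x := by simp [mul_assoc]
  lact_ract a b x := by simp [mul_assoc]

@[simp] theorem self_lact_apply [IsScalarTower 𝕜 A A] [SMulCommClass 𝕜 A A] (a x : A) :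
    (self 𝕜 A).lact a x = a * x := by simp [self]

@[simp] theorem self_ract_apply [IsScalarTower 𝕜 A A] [SMulCommClass 𝕜 A A] (a x : A) :
    (self 𝕜 A).ract a x = x * a := by simp [self]

/-- Restriction of scalars along a bounded algebra homomorphism `j : S → A`. -/
noncomputable def restrict {S : Type u} [NonUnitalNormedRing S] [NormedSpace 𝕜 S]
    (M : BanachBimodule 𝕜 A X) (j : S →L[𝕜] A) (hj : ∀ s t, j (s * t) = j s * j t) :
    BanachBimodule 𝕜 S X where
  lact := M.lact ∘L j
  ract := M.ract ∘L j
  lact_mul a b x := by simp [hj, M.lact_mul]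
  ract_mul a b x := by simp [hj, M.ract_mul]
  lact_ract a b x := by simp [M.lact_ract]

/-- `D : A → X` is a (bounded) derivation: `D(ab) = a.D(b) + D(a).b`. -/
def IsDerivation (M : BanachBimodule 𝕜 A X) (D : A →L[𝕜] X) : Prop :=
  ∀ a b, D (a * b) = M.lact a (D b) + M.ract b (D a)

/-- `D` is of the form `a ↦ a.x - x.a`. -/
def IsInner (M : BanachBimodule 𝕜 A X) (D : A →L[𝕜] X) : Prop :=
  ∃ x : X, ∀ a, D a = M.lact a x - M.ract a x

/-- `D(a)` is the norm limit of `a.x - x.a`, for every `a`, as `x` runs along one net in `X` that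
does not depend on `a`; nets in `X` are given by proper filters on `X`. -/
def IsApproximatelyInner (M : BanachBimodule 𝕜 A X) (D : A →L[𝕜] X) : Prop :=
  ∃ l : Filter X, l.NeBot ∧ ∀ a, Tendsto (fun x => M.lact a x - M.ract a x) l (𝓝 (D a))

/-- The pair `(S, T)` is a double centralizer from `A` into `X`: `S` is a bounded right module
homomorphism, `T` is a bounded left module homomorphism, and `a.S(b) = T(a).b`. -/
structure IsDoubleCentralizer (M : BanachBimodule 𝕜 A X) (S T : A →L[𝕜] X) : Prop where
  right_hom : ∀ a b, S (a * b) = M.ract b (S a)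
  left_hom : ∀ a b, T (a * b) = M.lact a (T b)
  compat : ∀ a b, M.lact a (S b) = M.ract b (T a)

end BanachBimodule

/-- `A` is amenable: for every Banach `A`-bimodule `X`, every bounded derivation `A → X*` is
inner. -/
def IsAmenable (𝕜 : Type) [RCLike 𝕜] (A : Type u) [NonUnitalNormedRing A] [NormedSpace 𝕜 A] :
    Prop :=
  ∀ (X : Type u) [NormedAddCommGroup X] [NormedSpace 𝕜 X] [CompleteSpace X]
    (M : BanachBimodule 𝕜 A X) (D : A →L[𝕜] StrongDual 𝕜 X),
    M.dual.IsDerivation D → M.dual.IsInner D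

/-- `A` is approximately weakly amenable: every bounded derivation `A → A*` is approximately
inner. -/
def IsApproximatelyWeaklyAmenable (𝕜 : Type) [RCLike 𝕜] (A : Type u) [NonUnitalNormedRing A]
    [NormedSpace 𝕜 A] [IsScalarTower 𝕜 A A] [SMulCommClass 𝕜 A A] : Prop :=
  ∀ D : A →L[𝕜] StrongDual 𝕜 A, (BanachBimodule.self 𝕜 A).dual.IsDerivation D →
    (BanachBimodule.self 𝕜 A).dual.IsApproximatelyInner D

/-- The bounded injective homomorphism `j : S → A` identifies `S` with a two-sided ideal of `A`, and
the norm of `S` satisfies `‖b s‖ ≤ C ‖s‖ ‖b‖` and `‖s b‖ ≤ C ‖s‖ ‖b‖` for `s` in `S` and `b` in `A`;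
that is, `A` is an envelope of `S`. -/
structure IsEnvelope {𝕜 : Type} [RCLike 𝕜]
    {S : Type u} [NonUnitalNormedRing S] [NormedSpace 𝕜 S]
    {A : Type u} [NonUnitalNormedRing A] [NormedSpace 𝕜 A] (j : S →L[𝕜] A) : Prop where
  injective : Function.Injective j
  map_mul : ∀ s t, j (s * t) = j s * j t
  exists_bound : ∃ C : ℝ, 0 < C ∧ ∀ (s : S) (b : A),
    (∃ t : S, j t = b * j s ∧ ‖t‖ ≤ C * ‖s‖ * ‖b‖) ∧
    (∃ t : S, j t = j s * b ∧ ‖t‖ ≤ C * ‖s‖ * ‖b‖)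

/-- `S` is, through the inclusion `j`, an abstract symmetric Segal algebra in `A`: `A` is an envelope
of `S` and `S` is dense in `A`. -/
structure IsSymmetricSegalAlgebra {𝕜 : Type} [RCLike 𝕜]
    {S : Type u} [NonUnitalNormedRing S] [NormedSpace 𝕜 S]
    {A : Type u} [NonUnitalNormedRing A] [NormedSpace 𝕜 A] (j : S →L[𝕜] A) : Prop
    extends IsEnvelope j where
  dense : DenseRange j

/-- The net in `S` given by the filter `l` is a (two-sided) approximate identity for `S`, and its
image under `j` is a bounded (two-sided) approximate identity for `A`. -/
structure IsApproximateIdentityBoundedIn {𝕜 : Type} [RCLike 𝕜]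
    {S : Type u} [NonUnitalNormedRing S] [NormedSpace 𝕜 S]
    {A : Type u} [NonUnitalNormedRing A] [NormedSpace 𝕜 A] (j : S →L[𝕜] A) (l : Filter S) :
    Prop where
  approx_small : l.IsApproximateUnit
  approx_big : (l.map j).IsApproximateUnit
  bounded : ∃ K : ℝ, ∀ᶠ e in l, ‖j e‖ ≤ K

/-! For a derivation D : S → X put δ(b)(s) = D(bs) - b.D(s), the failure of D to be left A-linear.
Each δ(b) is a right S-module map, and δ is a derivation of A into the bimodule Z of such maps.
Amenability makes δ inner in Z**, and an implementing element of Z** yields a right module map T : S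
→ X** with D(s).t = s.T(t) - T(s).t. Hence (-T, -(D + T)) is a double centralizer whose difference
is D (`exists_isDoubleCentralizer_bidual`). For a dual bimodule, the projection X*** → X* brings the
pair back.

For approximate innerness, let (P, Q) be the pair in X** and e the approximate identity. The
elements -P(e) nearly work: they give P(ea) - Q(a).e, but Q(a).e need not tend to Q(a). Boundedness
in A provides a weak-* limit operator R(f) = lim f.e, and adding R(Q(e)) - Q(e) repairs the defect
(`exists_tendsto_inner_of_isDoubleCentralizer`). Hahn-Banach then replaces elements of X** by
elements of X (`isApproximatelyInner_of_bidual`). -/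

namespace BanachBimodule

set_option maxSynthPendingDepth 3

variable {𝕜 : Type} [RCLike 𝕜]
variable {A : Type u} [NonUnitalNormedRing A] [NormedSpace 𝕜 A]
variable {X : Type u} [NormedAddCommGroup X] [NormedSpace 𝕜 X]
variable {Y : Type u} [NormedAddCommGroup Y] [NormedSpace 𝕜 Y]

/-! ### Auxiliary bimodules. -/

/-- The bimodule structure on a subspace that is stable under both actions. -/
noncomputable def submodule (M : BanachBimodule 𝕜 A X) (N : Submodule 𝕜 X)
    (hl : ∀ a, ∀ x ∈ N, M.lact a x ∈ N) (hr : ∀ a, ∀ x ∈ N, M.ract a x ∈ N) :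
    BanachBimodule 𝕜 A N where
  lact := LinearMap.mkContinuous₂ (LinearMap.mk₂ 𝕜 (fun a (x : N) => (⟨M.lact a x, hl a x x.2⟩ : N))
    (by intros; ext; simp) (by intros; ext; simp) (by intros; ext; simp) (by intros; ext; simp))
    ‖M.lact‖ (fun a x => M.lact.le_opNorm₂ a x)
  ract := LinearMap.mkContinuous₂ (LinearMap.mk₂ 𝕜 (fun a (x : N) => (⟨M.ract a x, hr a x x.2⟩ : N))
    (by intros; ext; simp) (by intros; ext; simp) (by intros; ext; simp) (by intros; ext; simp))
    ‖M.ract‖ (fun a x => M.ract.le_opNorm₂ a x)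
  lact_mul a b x := Subtype.ext (M.lact_mul a b x)
  ract_mul a b x := Subtype.ext (M.ract_mul a b x)
  lact_ract a b x := Subtype.ext (M.lact_ract a b x)

@[simp] theorem coe_submodule_lact (M : BanachBimodule 𝕜 A X) (N : Submodule 𝕜 X)
    (hl : ∀ a, ∀ x ∈ N, M.lact a x ∈ N) (hr : ∀ a, ∀ x ∈ N, M.ract a x ∈ N) (a : A) (x : N) :
    ((M.submodule N hl hr).lact a x : X) = M.lact a x := rfl

@[simp] theorem coe_submodule_ract (M : BanachBimodule 𝕜 A X) (N : Submodule 𝕜 X)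
    (hl : ∀ a, ∀ x ∈ N, M.lact a x ∈ N) (hr : ∀ a, ∀ x ∈ N, M.ract a x ∈ N) (a : A) (x : N) :
    ((M.submodule N hl hr).ract a x : X) = M.ract a x := rfl

/-- The bounded operators `X → Y` as a bimodule: `(a.T)(x) = a.T(x)` and `(T.a)(x) = T(a.x)`. -/
noncomputable def hom (M : BanachBimodule 𝕜 A X) (N : BanachBimodule 𝕜 A Y) :
    BanachBimodule 𝕜 A (X →L[𝕜] Y) where
  lact := ContinuousLinearMap.compL 𝕜 X Y Y ∘L N.lact
  ract := (ContinuousLinearMap.compL 𝕜 X X Y).flip ∘L M.lact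
  lact_mul a b T := by ext x; simp [N.lact_mul]
  ract_mul a b T := by ext x; simp [M.lact_mul]
  lact_ract a b T := by ext x; simp

@[simp] theorem hom_lact_apply (M : BanachBimodule 𝕜 A X) (N : BanachBimodule 𝕜 A Y) (a : A)
    (T : X →L[𝕜] Y) (x : X) : (M.hom N).lact a T x = N.lact a (T x) := by simp [hom]

@[simp] theorem hom_ract_apply (M : BanachBimodule 𝕜 A X) (N : BanachBimodule 𝕜 A Y) (a : A)
    (T : X →L[𝕜] Y) (x : X) : (M.hom N).ract a T x = T (M.lact a x) := by simp [hom]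

section restrict

variable {S : Type u} [NonUnitalNormedRing S] [NormedSpace 𝕜 S]

@[simp] theorem restrict_lact_apply (M : BanachBimodule 𝕜 A X) (j : S →L[𝕜] A)
    (hj : ∀ s t, j (s * t) = j s * j t) (s : S) : (M.restrict j hj).lact s = M.lact (j s) := rfl

@[simp] theorem restrict_ract_apply (M : BanachBimodule 𝕜 A X) (j : S →L[𝕜] A)
    (hj : ∀ s t, j (s * t) = j s * j t) (s : S) : (M.restrict j hj).ract s = M.ract (j s) := rfl

end restrict

end BanachBimodule

namespace IsEnvelope

variable {𝕜 : Type} [RCLike 𝕜]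
variable {S : Type u} [NonUnitalNormedRing S] [NormedSpace 𝕜 S]
variable {A : Type u} [NonUnitalNormedRing A] [NormedSpace 𝕜 A] [IsScalarTower 𝕜 A A]
  [SMulCommClass 𝕜 A A]
variable {j : S →L[𝕜] A}

/-- An ideal is a bimodule over its envelope. -/
theorem exists_bimodule (hj : IsEnvelope j) : ∃ E : BanachBimodule 𝕜 A S,
    (∀ b s, j (E.lact b s) = b * j s) ∧ ∀ b s, j (E.ract b s) = j s * b := by
  obtain ⟨C, -, hC⟩ := hj.exists_bound
  choose l hl hlC using fun b s => (hC s b).1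
  choose r hr hrC using fun b s => (hC s b).2
  refine ⟨{
    lact := LinearMap.mkContinuous₂ (LinearMap.mk₂ 𝕜 l ?_ ?_ ?_ ?_) C ?_
    ract := LinearMap.mkContinuous₂ (LinearMap.mk₂ 𝕜 r ?_ ?_ ?_ ?_) C ?_
    lact_mul := ?_
    ract_mul := ?_
    lact_ract := ?_ }, hl, hr⟩
  case refine_5 => intro b s; rw [mul_right_comm]; exact hlC b s
  case refine_10 => intro b s; rw [mul_right_comm]; exact hrC b s
  -- Bilinearity and the module axioms hold for the chosen preimages because their images under `j`
  -- obey the ring axioms of A.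
  all_goals intros; apply hj.injective; simp [hl, hr, mul_add, add_mul, mul_assoc, smul_mul_assoc,
    mul_smul_comm]

end IsEnvelope

namespace BanachBimodule

set_option maxSynthPendingDepth 3

variable {𝕜 : Type} [RCLike 𝕜]
variable {S : Type u} [NonUnitalNormedRing S] [NormedSpace 𝕜 S]
variable {A : Type u} [NonUnitalNormedRing A] [NormedSpace 𝕜 A]
variable {X : Type u} [NormedAddCommGroup X] [NormedSpace 𝕜 X]
variable {Y : Type u} [NormedAddCommGroup Y] [NormedSpace 𝕜 Y]

/-! ### Double centralizers from amenability. -/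

/-- The bounded right `S`-module homomorphisms from `S` to a bimodule. -/
def rightHom [IsScalarTower 𝕜 S S] (M : BanachBimodule 𝕜 S X) : Submodule 𝕜 (S →L[𝕜] X) where
  carrier := {T | ∀ s t, T (s * t) = M.ract t (T s)}
  add_mem' hT hU s t := by simp [hT s t, hU s t]
  zero_mem' s t := by simp
  smul_mem' c T hT s t := by simp [hT s t]

/-- If a derivation into a bimodule `Z` of operators is inner in the bidual of `Z`, then it is
implemented by an operator into the bidual. -/
theorem exists_implementing_operator (hA : IsAmenable 𝕜 A) {Z : Type u} [NormedAddCommGroup Z]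
    [NormedSpace 𝕜 Z] {E : BanachBimodule 𝕜 A Y} {M : BanachBimodule 𝕜 A X}
    {ZM : BanachBimodule 𝕜 A Z} (ι : Z →L[𝕜] Y →L[𝕜] X)
    (hl : ∀ a z y, ι (ZM.lact a z) y = M.lact a (ι z y))
    (hr : ∀ a z y, ι (ZM.ract a z) y = ι z (E.lact a y))
    {δ : A →L[𝕜] Z} (hδ : ZM.IsDerivation δ) :
    ∃ T : Y →L[𝕜] StrongDual 𝕜 (StrongDual 𝕜 X),
      (∀ a y φ, φ (ι (δ a) y) = M.dual.dual.lact a (T y) φ - T (E.lact a y) φ) ∧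
      ∀ y y' φ φ', (∀ z, φ (ι z y) = φ' (ι z y')) → T y φ = T y' φ' := by
  have hδ' (a b : A) : δ (a * b) = ZM.lact a (δ b) + ZM.ract b (δ a) := hδ a b
  -- Amenability concerns dual bimodules only, so δ is viewed in Z** = (Z*)*.
  obtain ⟨g, hg⟩ := hA (StrongDual 𝕜 Z) ZM.dual (NormedSpace.inclusionInDoubleDual 𝕜 Z ∘L δ)
    (fun a b => by ext φ; simp [hδ'])
  let ev : Y →L[𝕜] StrongDual 𝕜 X →L[𝕜] StrongDual 𝕜 Z :=
    (ContinuousLinearMap.compL 𝕜 Z X 𝕜).flip ∘L ι.flip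
  have hev (y : Y) (φ : StrongDual 𝕜 X) (z : Z) : ev y φ z = φ (ι z y) := by simp [ev]
  let T : Y →L[𝕜] StrongDual 𝕜 (StrongDual 𝕜 X) :=
    ContinuousLinearMap.compL 𝕜 (StrongDual 𝕜 X) (StrongDual 𝕜 Z) 𝕜 g ∘L ev
  have hT (y : Y) (φ : StrongDual 𝕜 X) : T y φ = g (ev y φ) := by simp [T]
  refine ⟨T, fun a y φ => ?_, fun y y' φ φ' h => ?_⟩
  · have h₁ : ZM.dual.ract a (ev y φ) = ev y (M.dual.ract a φ) := by ext z; simp [hev, hl]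
    have h₂ : ZM.dual.lact a (ev y φ) = ev (E.lact a y) φ := by ext z; simp [hev, hr]
    have := congrArg (fun f => f (ev y φ)) (hg a)
    simpa [hev, h₁, h₂, hT] using this
  · rw [hT, hT]
    congr 1
    ext z
    rw [hev, hev, h]

/-- Over an amenable envelope, the failure of a derivation to be a left module homomorphism is
compensated by a right module homomorphism into the bidual. -/
theorem exists_rightHom_bidual [IsScalarTower 𝕜 S S] [IsScalarTower 𝕜 A A]
    [SMulCommClass 𝕜 A A] {j : S →L[𝕜] A}
    (hj : IsEnvelope j) (hA : IsAmenable 𝕜 A) (M : BanachBimodule 𝕜 A X) {D : S →L[𝕜] X}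
    (hD : (M.restrict j hj.map_mul).IsDerivation D) :
    ∃ T : S →L[𝕜] StrongDual 𝕜 (StrongDual 𝕜 X),
      (∀ s t, T (s * t) = M.dual.dual.ract (j t) (T s)) ∧
      ∀ s t, NormedSpace.inclusionInDoubleDual 𝕜 X (D (s * t) - M.lact (j s) (D t))
        = M.dual.dual.lact (j s) (T t) - T (s * t) := by
  obtain ⟨E, hEl, -⟩ := hj.exists_bimodule
  have hE_self (s t : S) : E.lact (j s) t = s * t := hj.injective (by rw [hEl, hj.map_mul])
  have hE_mul (b : A) (s t : S) : E.lact b (s * t) = E.lact b s * t :=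
    hj.injective (by simp only [hEl, hj.map_mul, mul_assoc])
  have hD' (s t : S) : D (s * t) = M.lact (j s) (D t) + M.ract (j t) (D s) := hD s t
  -- Working in Z rather than in all operators is what makes T a right module map: for U in Z, the
  -- functionals U ↦ φ(U(st)) and U ↦ φ(U(s).t) coincide.
  let Z := (M.restrict j hj.map_mul).rightHom
  let ZM : BanachBimodule 𝕜 A Z := (E.hom M).submodule Z
    (fun a T hT s t => by
      rw [hom_lact_apply, hom_lact_apply, hT s t]; exact M.lact_ract a (j t) (T s))
    (fun a T hT s t => by rw [hom_ract_apply, hom_ract_apply, hE_mul, hT])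
  have hZl (a : A) (T : Z) (s : S) :
      (ZM.lact a T : S →L[𝕜] X) s = M.lact a ((T : S →L[𝕜] X) s) := hom_lact_apply E M a T s
  have hZr (a : A) (T : Z) (s : S) :
      (ZM.ract a T : S →L[𝕜] X) s = (T : S →L[𝕜] X) (E.lact a s) :=
    hom_ract_apply E M a T s
  let δ₀ : A →L[𝕜] S →L[𝕜] X :=
    ContinuousLinearMap.compL 𝕜 S S X D ∘L E.lact
      - (ContinuousLinearMap.compL 𝕜 S X X).flip D ∘L M.lact
  have hδ₀ (b : A) (s : S) : δ₀ b s = D (E.lact b s) - M.lact b (D s) := by simp [δ₀]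
  let δ : A →L[𝕜] Z := δ₀.codRestrict Z fun b s t => by
    rw [hδ₀, hδ₀, hE_mul, hD', hD', hEl, M.lact_mul, restrict_ract_apply, map_add, map_sub,
      M.lact_ract]
    abel
  have hδ (b : A) (s : S) : (δ b : S →L[𝕜] X) s = D (E.lact b s) - M.lact b (D s) := hδ₀ b s
  have hδ_mul (a b : A) : δ (a * b) = ZM.lact a (δ b) + ZM.ract b (δ a) := by
    ext1
    ext1 s
    rw [Submodule.coe_add, add_apply, hZl, hZr]
    simp only [hδ, map_sub, E.lact_mul, M.lact_mul]
    abel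
  obtain ⟨T, hT_inner, hT_ext⟩ :=
    exists_implementing_operator hA (ZM := ZM) Z.subtypeL hZl hZr hδ_mul
  have hT_right (s t : S) : T (s * t) = M.dual.dual.ract (j t) (T s) := by
    ext φ
    rw [dual_ract_apply]
    exact hT_ext _ _ _ _ fun U => by simpa using congrArg φ (U.2 s t)
  refine ⟨T, hT_right, fun s t => ?_⟩
  ext φ
  simpa [hδ, hE_self] using hT_inner (j s) t φ

/-- Over an amenable envelope, every derivation comes from a double centralizer into the bidual. -/
theorem exists_isDoubleCentralizer_bidual [IsScalarTower 𝕜 S S] [IsScalarTower 𝕜 A A]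
    [SMulCommClass 𝕜 A A] {j : S →L[𝕜] A}
    (hj : IsEnvelope j) (hA : IsAmenable 𝕜 A) (M : BanachBimodule 𝕜 A X) {D : S →L[𝕜] X}
    (hD : (M.restrict j hj.map_mul).IsDerivation D) :
    ∃ P Q : S →L[𝕜] StrongDual 𝕜 (StrongDual 𝕜 X),
      (M.dual.dual.restrict j hj.map_mul).IsDoubleCentralizer P Q ∧
        ∀ a, NormedSpace.inclusionInDoubleDual 𝕜 X (D a) = P a - Q a := by
  obtain ⟨T, hT_right, hT_left⟩ := exists_rightHom_bidual hj hA M hD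
  have hD' (s t : S) : D (s * t) = M.lact (j s) (D t) + M.ract (j t) (D s) := hD s t
  let I := NormedSpace.inclusionInDoubleDual 𝕜 X
  have hI_lact (a : A) (x : X) : I (M.lact a x) = M.dual.dual.lact a (I x) := by ext; simp [I]
  have hI_ract (a : A) (x : X) : I (M.ract a x) = M.dual.dual.ract a (I x) := by ext; simp [I]
  -- By the derivation rule, `hT_left` reads D(a).b = a.T(b) - T(a).b, which is the compatibility
  -- condition.
  refine ⟨-T, -(I ∘L D + T), ⟨fun a b => ?_, fun a b => ?_, fun a b => ?_⟩, fun a => ?_⟩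
  · simp [hT_right]
  · have h : I (D (a * b)) - M.dual.dual.lact (j a) (I (D b))
        = M.dual.dual.lact (j a) (T b) - T (a * b) := by rw [← hI_lact, ← map_sub]; exact hT_left a b
    simp only [neg_apply, add_apply, ContinuousLinearMap.comp_apply, restrict_lact_apply,
      map_neg, map_add, neg_inj]
    rw [← sub_eq_zero, ← sub_eq_zero.2 h]
    abel
  · have h := hT_left a b
    rw [hD', add_sub_cancel_left, hT_right, eq_sub_iff_add_eq] at h
    simp only [neg_apply, add_apply, ContinuousLinearMap.comp_apply, restrict_lact_apply,
      restrict_ract_apply, map_neg, map_add, neg_inj, ← hI_ract]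
    exact h.symm
  · simp [I]

/-- Over an amenable envelope, every derivation into a dual bimodule comes from a double
centralizer. -/
theorem exists_isDoubleCentralizer [IsScalarTower 𝕜 S S] [IsScalarTower 𝕜 A A]
    [SMulCommClass 𝕜 A A] {j : S →L[𝕜] A} (hj : IsEnvelope j)
    (hA : IsAmenable 𝕜 A) (M : BanachBimodule 𝕜 A X) {D : S →L[𝕜] StrongDual 𝕜 X}
    (hD : (M.dual.restrict j hj.map_mul).IsDerivation D) :
    ∃ P Q : S →L[𝕜] StrongDual 𝕜 X,
      (M.dual.restrict j hj.map_mul).IsDoubleCentralizer P Q ∧ ∀ a, D a = P a - Q a := by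
  obtain ⟨P, Q, h, hPQ⟩ := exists_isDoubleCentralizer_bidual hj hA M.dual hD
  let I := NormedSpace.inclusionInDoubleDual 𝕜 X
  -- Restriction of functionals along X → X**: a bimodule map and a left inverse of the embedding X*
  -- → X***.
  let π : StrongDual 𝕜 (StrongDual 𝕜 (StrongDual 𝕜 X)) →L[𝕜] StrongDual 𝕜 X :=
    (ContinuousLinearMap.compL 𝕜 X (StrongDual 𝕜 (StrongDual 𝕜 X)) 𝕜).flip I
  have hI_lact (a : A) (x : X) : M.dual.dual.lact a (I x) = I (M.lact a x) := by ext; simp [I]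
  have hI_ract (a : A) (x : X) : M.dual.dual.ract a (I x) = I (M.ract a x) := by ext; simp [I]
  refine ⟨π ∘L P, π ∘L Q, ⟨fun a b => ?_, fun a b => ?_, fun a b => ?_⟩, fun a => ?_⟩
  · ext x
    simp [π, h.right_hom, hI_lact]
  · ext x
    simp [π, h.left_hom, hI_ract]
  · ext x
    have := congrArg (fun f => f (I x)) (h.compat a b)
    simpa [π, hI_lact, hI_ract] using this
  · ext x
    have := congrArg (fun f => f (I x)) (hPQ a)
    simpa [π, I] using this

end BanachBimodule

/-! ### Weak-* limits and closures of subspaces. -/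

namespace StrongDual

set_option maxSynthPendingDepth 3

variable {𝕜 : Type*} [RCLike 𝕜] {E : Type*} [NormedAddCommGroup E] [NormedSpace 𝕜 E]

/-- Weak-* limits, along an ultrafilter, of the adjoints of a bounded family of operators. -/
theorem exists_ultrafilter_limit_adjoint {ι : Type*} (U : Ultrafilter ι) (T : ι → E →L[𝕜] E)
    {K : ℝ} (hT : ∀ᶠ i in (U : Filter ι), ‖T i‖ ≤ K) :
    ∃ R : StrongDual 𝕜 E →L[𝕜] StrongDual 𝕜 E,
      ∀ f x, Tendsto (fun i => f (T i x)) U (𝓝 (R f x)) := by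
  have hbound (f : StrongDual 𝕜 E) (x : E) : ∀ᶠ i in (U : Filter ι),
      ‖f (T i x)‖ ≤ K * ‖f‖ * ‖x‖ := by
    filter_upwards [hT] with i hi
    calc ‖f (T i x)‖ ≤ ‖f‖ * (‖T i‖ * ‖x‖) := f.le_opNorm_of_le ((T i).le_opNorm x)
      _ ≤ ‖f‖ * (K * ‖x‖) := by gcongr
      _ = K * ‖f‖ * ‖x‖ := by ring
  have hlim (f : StrongDual 𝕜 E) (x : E) :
      ∃ c : 𝕜, Tendsto (fun i => f (T i x)) U (𝓝 c) := by
    obtain ⟨c, -, hc⟩ := (isCompact_closedBall (0 : 𝕜) (K * ‖f‖ * ‖x‖)).ultrafilter_le_nhds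
      (U.map fun i => f (T i x)) (le_principal_iff.2 <|
        (hbound f x).mono fun i hi => mem_closedBall_zero_iff.2 hi)
    exact ⟨c, hc⟩
  choose r hr using hlim
  refine ⟨LinearMap.mkContinuous₂ (LinearMap.mk₂ 𝕜 r (fun f g x => ?_) (fun c f x => ?_)
    (fun f x y => ?_) (fun c f x => ?_)) K fun f x =>
      le_of_tendsto (hr f x).norm (hbound f x), hr⟩
  · exact tendsto_nhds_unique (hr _ _) ((hr f x).add (hr g x))
  · exact tendsto_nhds_unique (hr _ _) ((hr f x).const_smul c)
  · refine tendsto_nhds_unique (hr _ _) (((hr f x).add (hr f y)).congr fun i => ?_)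
    simp
  · refine tendsto_nhds_unique (hr _ _) (((hr f x).const_smul c).congr fun i => ?_)
    simp

end StrongDual

/-- A point belongs to the closure of a subspace if every functional vanishing on the subspace
vanishes at the point. -/
theorem Submodule.mem_topologicalClosure_of_forall_dual {𝕜 : Type*} [RCLike 𝕜] {E : Type*}
    [NormedAddCommGroup E] [NormedSpace 𝕜 E] (V : Submodule 𝕜 E) {x : E}
    (h : ∀ f : StrongDual 𝕜 E, (∀ v ∈ V, f v = 0) → f x = 0) : x ∈ V.topologicalClosure := by
  have : IsClosed (V.topologicalClosure : Set E) := V.isClosed_topologicalClosure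
  by_contra hx
  obtain ⟨g, hg⟩ := SeparatingDual.exists_ne_zero (R := 𝕜)
    (mt (Submodule.Quotient.mk_eq_zero V.topologicalClosure).1 hx)
  refine hg (h (g ∘L V.topologicalClosure.mkQL) fun v hv => ?_)
  have : V.topologicalClosure.mkQ v = 0 :=
    (Submodule.Quotient.mk_eq_zero _).2 (V.le_topologicalClosure hv)
  simp [this]

namespace BanachBimodule

set_option maxSynthPendingDepth 3

variable {𝕜 : Type} [RCLike 𝕜]
variable {A : Type u} [NonUnitalNormedRing A] [NormedSpace 𝕜 A]
variable {X : Type u} [NormedAddCommGroup X] [NormedSpace 𝕜 X]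

/-! ### Approximate innerness. -/

/-- A map that is a pointwise limit of inner derivations by elements of the bidual, in the weak-*
topology, is approximately inner. -/
theorem isApproximatelyInner_of_bidual (M : BanachBimodule 𝕜 A X) (D : A →L[𝕜] X)
    {ι : Type*} {l : Filter ι} [l.NeBot] (ξ : ι → StrongDual 𝕜 (StrongDual 𝕜 X))
    (h : ∀ a (f : StrongDual 𝕜 X), Tendsto
      (fun i => (M.dual.dual.lact a (ξ i) - M.dual.dual.ract a (ξ i)) f) l (𝓝 (f (D a)))) :
    M.IsApproximatelyInner D := by
  classical
  -- This filter is universal for pointwise convergence to D; its properness only requires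
  -- approximating D at finitely many elements at once.
  refine ⟨comap (fun x a => M.lact a x - M.ract a x) (𝓝 ⇑D), ?_, fun a =>
    tendsto_pi_nhds.1 (tendsto_comap (f := fun x a => M.lact a x - M.ract a x)) a⟩
  refine comap_neBot fun t ht => ?_
  rw [nhds_pi, mem_pi'] at ht
  obtain ⟨I, s, hs, hst⟩ := ht
  let g : X →L[𝕜] I → X := ContinuousLinearMap.pi fun a => M.lact a - M.ract a
  have hg (x : X) (a : I) : g x a = M.lact a x - M.ract a x := by simp [g]
  have hmem : (fun a : I => D a) ∈ (LinearMap.range (g : X →ₗ[𝕜] I → X)).topologicalClosure := by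
    refine Submodule.mem_topologicalClosure_of_forall_dual _ fun F hF => ?_
    let φ (a : I) : StrongDual 𝕜 X := F ∘L ContinuousLinearMap.single 𝕜 (fun _ : I => X) a
    have hφ (v : I → X) : F v = ∑ a, φ a (v a) := by
      rw [← F.sum_comp_single]
    -- A functional F = (φ_a) on X^I kills every tuple (a.x - x.a) exactly when this sum vanishes in
    -- X*. Each ξ_i then kills it too, so F vanishes at (D(a)) in the limit.
    have hzero : ∑ a : I, (M.dual.ract a (φ a) - M.dual.lact a (φ a)) = 0 := by
      ext x
      have := hF (g x) ⟨x, rfl⟩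
      rw [hφ] at this
      simpa [hg, sum_apply] using this
    rw [hφ]
    refine tendsto_nhds_unique (tendsto_finsetSum Finset.univ fun a _ => h a (φ a))
      (tendsto_const_nhds.congr fun i => ?_)
    rw [← map_zero (ξ i), ← hzero, map_sum]
    simp
  obtain ⟨y, hy, x, rfl⟩ := mem_closure_iff_nhds.1 hmem (Set.pi Set.univ fun a : I => s a)
    (set_pi_mem_nhds Set.finite_univ fun a _ => hs a)
  exact ⟨x, hst fun a ha => by simpa [hg] using hy ⟨a, ha⟩ trivial⟩

variable {S : Type u} [NonUnitalNormedRing S] [NormedSpace 𝕜 S]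

/-- In the presence of an approximate identity that is bounded in the larger algebra, a map into the
bidual that comes from a double centralizer is a weak-* limit of inner derivations. -/
theorem exists_tendsto_inner_of_isDoubleCentralizer (M : BanachBimodule 𝕜 A X) {j : S →L[𝕜] A}
    (hj : ∀ s t, j (s * t) = j s * j t) {l : Filter S} (hl : IsApproximateIdentityBoundedIn j l)
    {P Q : S →L[𝕜] StrongDual 𝕜 X} (hPQ : (M.dual.restrict j hj).IsDoubleCentralizer P Q) :
    ∃ (U : Ultrafilter S) (ξ : S → StrongDual 𝕜 X), ∀ a x, Tendsto
      (fun e => ((M.dual.restrict j hj).lact a (ξ e) - (M.dual.restrict j hj).ract a (ξ e)) x) U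
      (𝓝 ((P a - Q a) x)) := by
  have := hl.approx_small.neBot
  let U := Ultrafilter.of l
  have hU : (U : Filter S) ≤ l := Ultrafilter.of_le l
  obtain ⟨K, hK⟩ := hl.bounded
  obtain ⟨R, hR⟩ := StrongDual.exists_ultrafilter_limit_adjoint U (fun e => M.lact (j e))
    (K := ‖M.lact‖ * K) (by
      filter_upwards [hU hK] with e he
      exact M.lact.le_opNorm_of_le he)
  have hright (s : S) : Tendsto (fun e => e * s) U (𝓝 s) :=
    (hl.approx_small.tendsto_mul_right s).mono_left hU
  have hleft (s : S) : Tendsto (fun e => s * e) U (𝓝 s) :=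
    (hl.approx_small.tendsto_mul_left s).mono_left hU
  -- Since ea → a in S, R(f) and f have the same right translates by S, so R(f) - f is annihilated
  -- on the right.
  have hR_ract (a : S) (f : StrongDual 𝕜 X) : M.dual.ract (j a) (R f) = M.dual.ract (j a) f := by
    ext x
    rw [dual_ract_apply, dual_ract_apply]
    refine tendsto_nhds_unique (hR f _) ?_
    have : Continuous fun s => f (M.lact (j s) x) := by fun_prop
    exact ((this.tendsto a).comp (hright a)).congr fun e => by simp [hj, M.lact_mul]
  have hR_lact (a : S) (f : StrongDual 𝕜 X) : R (M.dual.lact (j a) f) = M.dual.lact (j a) (R f) := by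
    ext x
    rw [dual_lact_apply]
    refine tendsto_nhds_unique (hR _ x) ((hR f _).congr fun e => ?_)
    rw [dual_lact_apply, M.lact_ract]
  -- Here a.ξ_e - ξ_e.a = P(ea) + (R - 1)(Q(ae)) - Q(a).e. The limits are P(a), (R - 1)(Q(a)) and
  -- R(Q(a)), leaving P(a) - Q(a).
  refine ⟨U, fun e => R (Q e) - Q e - P e, fun a x => ?_⟩
  have hP (a b : S) : P (a * b) = M.dual.ract (j b) (P a) := hPQ.right_hom a b
  have hQ (a b : S) : Q (a * b) = M.dual.lact (j a) (Q b) := hPQ.left_hom a b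
  have hc (a b : S) : M.dual.lact (j a) (P b) = M.dual.ract (j b) (Q a) := hPQ.compat a b
  have hPl : Tendsto (fun e => P (e * a) x) U (𝓝 (P a x)) :=
    (((P.flip x).continuous).tendsto a).comp (hright a)
  have hQl : Tendsto (fun e => (R (Q (a * e)) - Q (a * e)) x) U (𝓝 ((R (Q a) - Q a) x)) :=
    ((((R ∘L Q - Q).flip x).continuous).tendsto a).comp (hleft a)
  convert (hPl.add hQl).sub (hR (Q a) x) using 2 with e
  · have h₁ := congrArg (fun f => f x) (hc a e)
    simp only [dual_ract_apply] at h₁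
    simp only [restrict_lact_apply, restrict_ract_apply, map_sub, hR_ract, hP, hQ, hR_lact,
      sub_apply, neg_apply, h₁, sub_self, zero_sub, dual_ract_apply]
    ring
  · simp only [sub_apply]
    ring

/-- Over an amenable envelope, and in the presence of an approximate identity that is bounded in the
envelope, every derivation is approximately inner. -/
theorem isApproximatelyInner_of_isDerivation [IsScalarTower 𝕜 S S] [IsScalarTower 𝕜 A A]
    [SMulCommClass 𝕜 A A] {j : S →L[𝕜] A} (hj : IsEnvelope j) (hA : IsAmenable 𝕜 A)
    {l : Filter S} (hl : IsApproximateIdentityBoundedIn j l) (M : BanachBimodule 𝕜 A X)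
    {D : S →L[𝕜] X} (hD : (M.restrict j hj.map_mul).IsDerivation D) :
    (M.restrict j hj.map_mul).IsApproximatelyInner D := by
  obtain ⟨P, Q, hPQ, hDPQ⟩ := exists_isDoubleCentralizer_bidual hj hA M hD
  obtain ⟨U, ξ, hξ⟩ := exists_tendsto_inner_of_isDoubleCentralizer M.dual hj.map_mul hl hPQ
  refine isApproximatelyInner_of_bidual _ D (l := U) ξ fun a f => ?_
  have := hξ a f
  rwa [← hDPQ] at this

end BanachBimodule

theorem theorem2p4 {𝕜 : Type} [RCLike 𝕜]
    {S : Type u} [NonUnitalNormedRing S] [NormedSpace 𝕜 S] [IsScalarTower 𝕜 S S]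
    [SMulCommClass 𝕜 S S] [CompleteSpace S]
    {A : Type u} [NonUnitalNormedRing A] [NormedSpace 𝕜 A] [IsScalarTower 𝕜 A A]
    [SMulCommClass 𝕜 A A] [CompleteSpace A]
    (j : S →L[𝕜] A) (hj : IsSymmetricSegalAlgebra j) (hA : IsAmenable 𝕜 A) :
    (∀ (X : Type u) [NormedAddCommGroup X] [NormedSpace 𝕜 X] [CompleteSpace X]
      (M : BanachBimodule 𝕜 A X) (D : S →L[𝕜] StrongDual 𝕜 X),
      (M.dual.restrict j hj.map_mul).IsDerivation D →
        ∃ P Q : S →L[𝕜] StrongDual 𝕜 X,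
          (M.dual.restrict j hj.map_mul).IsDoubleCentralizer P Q ∧ ∀ a, D a = P a - Q a) ∧
    ((∃ l : Filter S, IsApproximateIdentityBoundedIn j l) →
      (∀ (X : Type u) [NormedAddCommGroup X] [NormedSpace 𝕜 X] [CompleteSpace X]
        (M : BanachBimodule 𝕜 A X) (D : S →L[𝕜] X),
        (M.restrict j hj.map_mul).IsDerivation D →
          (M.restrict j hj.map_mul).IsApproximatelyInner D) ∧
      IsApproximatelyWeaklyAmenable 𝕜 S) := by
  refine ⟨fun X _ _ _ M D hD => BanachBimodule.exists_isDoubleCentralizer hj.toIsEnvelope hA M hD,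
    fun ⟨l, hl⟩ => ⟨fun X _ _ _ M D hD =>
      BanachBimodule.isApproximatelyInner_of_isDerivation hj.toIsEnvelope hA hl M hD,
      fun D hD => ?_⟩⟩
  obtain ⟨E, hEl, hEr⟩ := hj.exists_bimodule
  have hl_self (s t : S) : E.lact (j s) t = s * t := hj.injective (by rw [hEl, hj.map_mul])
  have hr_self (s t : S) : E.ract (j s) t = t * s := hj.injective (by rw [hEr, hj.map_mul])
  -- The ideal S is an A-bimodule, so S* is one too, and its restriction to S is the usual dual
  -- action.
  have hE : (BanachBimodule.self 𝕜 S).dual = E.dual.restrict j hj.map_mul := by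
    have h₁ : (BanachBimodule.self 𝕜 S).dual.lact = (E.dual.restrict j hj.map_mul).lact := by
      ext a f s; simp [hr_self]
    have h₂ : (BanachBimodule.self 𝕜 S).dual.ract = (E.dual.restrict j hj.map_mul).ract := by
      ext a f s; simp [hl_self]
    cases h₃ : (BanachBimodule.self 𝕜 S).dual
    cases h₄ : E.dual.restrict j hj.map_mul
    simp_all
  rw [hE] at hD ⊢
  exact BanachBimodule.isApproximatelyInner_of_isDerivation hj.toIsEnvelope hA hl E.dual hD
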